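/- Let $k\ge 3$ be a constant. For a finite simple graph $G$ with comparable node labels, write $x\prec y$ if $d(x)<d(y)$, or $d(x)=d(y)$ and $x<y$, where $d$ denotes the degree, and let $\Gamma^+(u)$ be the set of neighbours $x$ of $u$ with $u\prec x$. Algorithm $\mathrm{FFF}_k$ with pair sampling at probability $p\in[0,1]$ works in three MapReduce rounds: (1) compute $\Gamma^+(u)$ for every node $u$, and keep it if $|\Gamma^+(u)|\ge k-1$; (2) for every kept $\Gamma^+(u)$ and every pair $x\prec y$ in $\Gamma^+(u)$, emit $\langle (x,y);u\rangle$ with probability $p$, independently for all $u$ and all pairs, and then discard the pairs $(x,y)$ that are not edges of $G$; (3) for every $u$, collect the edges $(x,y)$ emitted for $u$, count the number $q_u$ of $(k-1)$-cliques that they form, and output $q_u/p^{(k-1)(k-2)/2}$. The estimate $\widetilde{q_k}$ is the sum of these outputs over all $u$. **Theorem.** For every constant $\varepsilon>0$ there exist a constant $h>0$ and an integer $m_0$, depending only on $k$ and $\varepsilon$, such that for every graph $G$ with $m\ge m_0$ edges and $q_k$ $k$-cliques, and every $p\in[0,1]$ with $$p^{(k-1)(k-2)/2}>\frac{h\,m^{(k-3)/2}\ln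 m}{\varepsilon^2 q_k},$$ the estimate $\widetilde{q_k}$ returned by $\mathrm{FFF}_k$ with pair sampling at probability $p$ satisfies $|\widetilde{q_k}-q_k|\le\varepsilon q_k$ with probability at least $1-1/m$. -/

import Mathlib

open MeasureTheory ProbabilityTheory

namespace CliqueMR

section MapReduce

variable {R K W O : Type*} [DecidableEq K] [DecidableEq W] [DecidableEq O]

/-- All the key-value pairs emitted by the map instances of a round, one instance per input
record.  Sets of records are enough here: in the algorithm below no key-value pair is emitted
twice in the same phase. -/
def mapPhase (f : R → Finset (K × W)) (input : Finset R) : Finset (K × W) :=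
  input.biUnion f

/-- The values that the shuffle phase delivers to the reduce instance with key `κ`. -/
def valuesAt (S : Finset (K × W)) (κ : K) : Finset W :=
  (S.filter fun z => z.1 = κ).image Prod.snd

/-- All the records emitted by the reduce instances of a round, one instance per key that
occurs in `S`. -/
def reducePhase (g : K → Finset W → Finset O) (S : Finset (K × W)) : Finset O :=
  (S.image Prod.fst).biUnion fun κ => g κ (valuesAt S κ)

end MapReduce

section Algorithm

variable {V : Type*} [Fintype V] [LinearOrder V] (G : SimpleGraph V) [DecidableRel G.Adj]

/-- The total order `x ≺ y` on the nodes: by degree, ties broken by the labels. -/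
def Prec (x y : V) : Prop :=
  G.degree x < G.degree y ∨ (G.degree x = G.degree y ∧ x < y)

instance : DecidableRel (Prec G) := fun x y =>
  inferInstanceAs (Decidable (G.degree x < G.degree y ∨ (G.degree x = G.degree y ∧ x < y)))

/-- The input: every edge, in both orientations. -/
def edgeRecords : Finset (V × V) :=
  Finset.univ.filter fun e => G.Adj e.1 e.2

/-- Map 1: on `(u, v)`, if `u ≺ v` then emit `⟨u; v⟩`.  (The endpoints of an edge are labelled
with their degree in the input, so a map instance can evaluate `≺`.) -/
def map1 (e : V × V) : Finset (V × V) :=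
  if Prec G e.1 e.2 then {e} else ∅

/-- Reduce 1: on `⟨u; Γ⁺(u)⟩`, if `|Γ⁺(u)| ≥ k - 1` then emit `⟨u; Γ⁺(u)⟩`. -/
def reduce1 (k : ℕ) (u : V) (Γ : Finset V) : Finset (V × Finset V) :=
  if k - 1 ≤ Γ.card then {(u, Γ)} else ∅

/-- Map 2 with pair sampling.  The value `none` is the symbol `$`.  On an edge `(u, v)` with
`u ≺ v`, emit `⟨(u, v); $⟩`.  On `⟨u; Γ⁺(u)⟩`, emit `⟨(x, y); u⟩` for each pair `x ≺ y` of nodes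
in `Γ⁺(u)` whose coin `coin (u, x, y)` came up heads. -/
def map2 (coin : V × V × V → Bool) :
    (V × V) ⊕ (V × Finset V) → Finset ((V × V) × Option V)
  | Sum.inl e => if Prec G e.1 e.2 then {(e, none)} else ∅
  | Sum.inr (u, Γ) =>
      ((Γ ×ˢ Γ).filter fun z => Prec G z.1 z.2 ∧ coin (u, z.1, z.2) = true).image
        fun z => (z, some u)

/-- Reduce 2: on `⟨(x, y); {u₁, …} ∪ $⟩`, emit `⟨(x, y); {u₁, …}⟩` if the values contain `$`,
that is, if `(x, y)` is an edge. -/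
def reduce2 (z : V × V) (U : Finset (Option V)) : Finset ((V × V) × Finset V) :=
  if none ∈ U then {(z, Finset.eraseNone U)} else ∅

/-- Map 3: on `⟨(x, y); {u₁, …}⟩`, emit `⟨uₕ; (x, y)⟩` for each `h`. -/
def map3 (r : (V × V) × Finset V) : Finset (V × (V × V)) :=
  r.2.image fun u => (u, r.1)

/-- The number of `j`-cliques (`j ≥ 2`) of the graph with the given list of edges. -/
def countCliques (j : ℕ) (E : Finset (V × V)) : ℕ :=
  ((SimpleGraph.fromRel fun x y : V => (x, y) ∈ E).cliqueFinset j).card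

/-- Reduce 3 with pair sampling: on `u` and the list of edges of `G⁺(u)` that it receives,
emit `⟨u; q / p ^ ((k - 1)(k - 2) / 2)⟩`, where `q` is the number of `(k - 1)`-cliques formed by
these edges.  (The division in the exponent is exact.) -/
noncomputable def reduce3 (k : ℕ) (p : ℝ) (u : V) (E : Finset (V × V)) : Finset (V × ℝ) :=
  {(u, (countCliques (k - 1) E : ℝ) / p ^ ((k - 1) * (k - 2) / 2))}

/-- Output of round 1: the high-neighbourhoods `⟨u; Γ⁺(u)⟩` with at least `k - 1` nodes. -/
def round1 (k : ℕ) : Finset (V × Finset V) :=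
  reducePhase (reduce1 k) (mapPhase (map1 G) (edgeRecords G))

/-- Output of round 2, which reads the output of round 1 together with the input edges. -/
def round2 (k : ℕ) (coin : V × V × V → Bool) : Finset ((V × V) × Finset V) :=
  reducePhase reduce2 (mapPhase (map2 G coin) ((edgeRecords G).disjSum (round1 G k)))

/-- Output of round 3: the partial estimates `⟨u; q / p ^ ((k - 1)(k - 2) / 2)⟩`. -/
noncomputable def round3 (k : ℕ) (p : ℝ) (coin : V × V × V → Bool) : Finset (V × ℝ) :=
  reducePhase (reduce3 k p) (mapPhase map3 (round2 G k coin))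

/-- The estimate of the number of `k`-cliques returned by `FFF_k` with pair sampling at
probability `p`, for the given outcomes of the coins: the sum of the partial estimates. -/
noncomputable def estimate (k : ℕ) (p : ℝ) (coin : V × V × V → Bool) : ℝ :=
  ∑ r ∈ round3 G k p coin, r.2

end Algorithm

/-- The law of the coins: independent, each one heads with probability `p`. -/
noncomputable def coinLaw (V : Type*) [Fintype V] (p : unitInterval) :
    Measure (V × V × V → Bool) :=
  Measure.pi fun _ => bernoulliMeasure true false p

end CliqueMR

/-! Root each `k`-clique at its `≺`-minimum `u`. It is counted exactly when the `e = (k-1)(k-2)/2`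
coins `(u, x, y)` of its other nodes all come up heads, so the estimate is the number of such
cliques divided by `p ^ e` (`estimate_eq_headsCount_div`). Cliques that share a coin are dependent.
But `|Γ⁺(u)| ≤ √(2m)`, so a coin lies in at most `B = ⌊√(2m)⌋ ^ (k-3)` cliques
(`exists_card_le_of_mem_coinsOf`). Greedy colouring splits the cliques into `χ = eB + 1` classes
with disjoint coin sets (`exists_coloring_disjoint`), hence independent. A Chernoff bound in each
class and a union bound over the classes give failure probability at most `2χ exp(-ε² q p^e / (8χ))`
for `ε ≤ 1` (`measureReal_abs_headsCount_sub_gt_le`). As `χ = O(m^((k-3)/2))`, the hypothesis on `p`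
makes the exponent at least `k ln m`, which beats the factor `2χ`. -/

namespace CliqueMR

/-! ### Concentration for weakly dependent all-heads events -/

section Concentration

variable {ι α : Type*}

/-- Greedy colouring: if every coin is used by at most `B` of the sets, then the sets can be
coloured with `e * B + 1` colours so that distinct sets of the same colour are disjoint. -/
lemma exists_coloring_disjoint (T : Finset α) (c : α → Finset ι) (e B : ℕ)
    (hcard : ∀ a ∈ T, (c a).card ≤ e)
    (hB : ∀ i, ∃ R : Finset α, R.card ≤ B ∧ ∀ a ∈ T, i ∈ c a → a ∈ R) :
    ∃ col : α → ℕ, (∀ a, col a < e * B + 1) ∧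
      ∀ a ∈ T, ∀ b ∈ T, a ≠ b → col a = col b → Disjoint (c a) (c b) := by
  classical
  choose R hR hTR using hB
  induction T using Finset.induction_on with
  | empty => exact ⟨fun _ => 0, by simp⟩
  | insert a T ha ih =>
    obtain ⟨col, hlt, hcol⟩ := ih (fun b hb => hcard b (Finset.mem_insert_of_mem hb))
      (fun i b hb => hTR i b (Finset.mem_insert_of_mem hb))
    -- Sets meeting `c a` use at most `e * B` colours, so one of `e * B + 1` is free.
    have hN : (((c a).biUnion R).image col).card < (Finset.range (e * B + 1)).card := by
      rw [Finset.card_range, Nat.lt_succ_iff]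
      exact Finset.card_image_le.trans <| (Finset.card_biUnion_le_card_mul _ _ B
        fun i _ => hR i).trans (Nat.mul_le_mul_right _ (hcard a (Finset.mem_insert_self _ _)))
    obtain ⟨x, hx, hxN⟩ := Finset.exists_mem_notMem_of_card_lt_card hN
    have key : ∀ b ∈ T, col b = x → Disjoint (c a) (c b) := by
      intro b hb hbx
      rw [Finset.disjoint_left]
      intro i hia hib
      exact hxN (Finset.mem_image.2 ⟨b, Finset.mem_biUnion.2
        ⟨i, hia, hTR i b (Finset.mem_insert_of_mem hb) hib⟩, hbx⟩)
    refine ⟨Function.update col a x, fun b => ?_, ?_⟩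
    · by_cases hb : b = a
      · subst hb; simpa using hx
      · simpa [Function.update_of_ne hb] using hlt b
    · intro b hb b' hb' hne heq
      rcases Finset.mem_insert.1 hb with rfl | hbT <;> rcases Finset.mem_insert.1 hb' with rfl | hb'T
      · exact absurd rfl hne
      · rw [Function.update_self, Function.update_of_ne hne.symm] at heq
        exact key b' hb'T heq.symm
      · rw [Function.update_self, Function.update_of_ne hne] at heq
        exact (key b hbT heq).symm
      · rw [Function.update_of_ne (ne_of_mem_of_not_mem hbT ha),
          Function.update_of_ne (ne_of_mem_of_not_mem hb'T ha)] at heq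
        exact hcol b hbT b' hb'T hne heq

/-- The number of `a ∈ S` all of whose coins come up heads. -/
def headsCount (S : Finset α) (c : α → Finset ι) (ω : ι → Bool) : ℕ :=
  (S.filter fun a => ∀ i ∈ c a, ω i = true).card

variable [Fintype ι]

/-- The probability that all the coins in `F` come up heads. -/
lemma measureReal_pi_forall_heads (p : unitInterval) (F : Finset ι) :
    (Measure.pi fun _ : ι => bernoulliMeasure true false p).real {ω | ∀ i ∈ F, ω i = true}
      = (p : ℝ) ^ F.card := by
  classical
  have h : {ω : ι → Bool | ∀ i ∈ F, ω i = true}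
      = Set.univ.pi fun i => if i ∈ F then {true} else Set.univ := by
    ext ω
    simp only [Set.mem_ofPred_eq, Set.mem_pi, Set.mem_univ, true_imp_iff]
    refine forall_congr' fun i => ?_
    by_cases hi : i ∈ F <;> simp [hi]
  rw [h, measureReal_def, Measure.pi_pi, ENNReal.toReal_prod]
  have h2 : ∀ i : ι, ((bernoulliMeasure true false p)
      (if i ∈ F then {true} else Set.univ)).toReal = if i ∈ F then (p : ℝ) else 1 := by
    intro i
    by_cases hi : i ∈ F <;> simp [hi]
  simp_rw [h2]
  simp [Finset.prod_ite_mem]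

/-- The events that all the coins of a set come up heads are independent for disjoint sets. -/
lemma iIndepSet_forall_heads (p : unitInterval) (S : Finset α) (c : α → Finset ι)
    (hdisj : (S : Set α).PairwiseDisjoint c) :
    iIndepSet (fun a : S => {ω : ι → Bool | ∀ i ∈ c a, ω i = true})
      (Measure.pi fun _ : ι => bernoulliMeasure true false p) := by
  classical
  rw [iIndepSet_iff_meas_biInter (fun _ => Set.Finite.measurableSet (Set.toFinite _))]
  intro s
  -- An intersection of all-heads events is the all-heads event of the union; disjointness makes the
  -- exponents of `p` add up.
  have h : (⋂ a ∈ s, {ω : ι → Bool | ∀ i ∈ c (a : α), ω i = true})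
      = {ω | ∀ i ∈ s.biUnion (fun a => c (a : α)), ω i = true} := by
    ext ω
    simp only [Set.mem_iInter, Set.mem_ofPred_eq, Finset.mem_biUnion]
    exact ⟨fun h i ⟨a, ha, hi⟩ => h a ha i hi, fun h a ha i hi => h i ⟨a, ha, hi⟩⟩
  rw [h, ← ENNReal.toReal_eq_toReal_iff' (by finiteness)
    (ENNReal.prod_ne_top fun _ _ => by finiteness), ENNReal.toReal_prod]
  simp only [← measureReal_def, measureReal_pi_forall_heads]
  rw [Finset.prod_pow_eq_pow_sum, Finset.card_biUnion]
  intro a _ b _ hab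
  exact hdisj a.2 b.2 (fun h => hab (Subtype.ext h))

lemma integrable_pi_bool (p : unitInterval) (f : (ι → Bool) → ℝ) :
    Integrable f (Measure.pi fun _ : ι => bernoulliMeasure true false p) :=
  Integrable.of_finite

/-- The count is a sum of independent indicators of mean `p ^ e`, and `exp t - 1 ≤ t + t ^ 2` for
`|t| ≤ 1`. Both signs of `t` are needed, one for each tail. -/
lemma mgf_headsCount_le (p : unitInterval) (S : Finset α) (c : α → Finset ι) {e : ℕ}
    (hdisj : (S : Set α).PairwiseDisjoint c) (hcard : ∀ a ∈ S, (c a).card = e)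
    {t : ℝ} (ht : |t| ≤ 1) :
    mgf (fun ω => (headsCount S c ω : ℝ))
      (Measure.pi fun _ : ι => bernoulliMeasure true false p) t
      ≤ Real.exp (S.card * (p : ℝ) ^ e * (t + t ^ 2)) := by
  classical
  set P := Measure.pi fun _ : ι => bernoulliMeasure true false p with hP
  have hind := (iIndepSet_forall_heads p S c hdisj).iIndepFun_indicator (m := Real.measurableSpace)
  have hsum : (fun ω => (headsCount S c ω : ℝ)) = ∑ a : S,
      ({ω : ι → Bool | ∀ i ∈ c (a : α), ω i = true}).indicator fun _ => (1 : ℝ) := by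
    ext ω
    rw [headsCount, Finset.card_filter, ← Finset.sum_coe_sort, Finset.sum_apply]
    push_cast
    refine Finset.sum_congr rfl fun a _ => ?_
    simp [Set.indicator_apply]
  rw [hsum, hind.mgf_sum (fun a => measurable_of_finite _)]
  have hmgf : ∀ a : S, mgf (({ω : ι → Bool | ∀ i ∈ c (a : α), ω i = true}).indicator
      fun _ => (1 : ℝ)) P t ≤ Real.exp ((p : ℝ) ^ e * (t + t ^ 2)) := by
    intro a
    have hA : P.real {ω : ι → Bool | ∀ i ∈ c (a : α), ω i = true} = (p : ℝ) ^ e := by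
      rw [hP, measureReal_pi_forall_heads, hcard a a.2]
    have heq : (fun ω => Real.exp (t * ({ω : ι → Bool | ∀ i ∈ c (a : α), ω i = true}).indicator
        (fun _ => (1 : ℝ)) ω)) = fun ω => 1 +
        ({ω : ι → Bool | ∀ i ∈ c (a : α), ω i = true}).indicator
          (fun _ => Real.exp t - 1) ω := by
      ext ω
      by_cases hω : ω ∈ {ω : ι → Bool | ∀ i ∈ c (a : α), ω i = true}
      · simp [Set.indicator_of_mem hω]
      · simp [Set.indicator_of_notMem hω]
    rw [mgf, heq, integral_add (integrable_pi_bool p _) (integrable_pi_bool p _),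
      integral_indicator_const _ (Set.Finite.measurableSet (Set.toFinite _)), hA]
    simp only [integral_const, probReal_univ, smul_eq_mul, one_mul]
    have h1 := (abs_le.1 (Real.abs_exp_sub_one_sub_id_le ht)).2
    have h2 : (0 : ℝ) ≤ (p : ℝ) ^ e := pow_nonneg p.2.1 _
    calc 1 + (p : ℝ) ^ e * (Real.exp t - 1)
        ≤ (p : ℝ) ^ e * (t + t ^ 2) + 1 := by nlinarith
      _ ≤ _ := Real.add_one_le_exp _
  calc _ ≤ ∏ _a : S, Real.exp ((p : ℝ) ^ e * (t + t ^ 2)) :=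
        Finset.prod_le_prod (fun a _ => mgf_nonneg) fun a _ => hmgf a
    _ = _ := by
        rw [Finset.prod_const, ← Real.exp_nat_mul]
        simp [mul_assoc]

/-- Two-sided Chernoff bound for the number of sets of coins, out of disjoint ones, all of whose
coins come up heads. -/
lemma measureReal_abs_headsCount_sub_ge_le (p : unitInterval) (S : Finset α) (c : α → Finset ι)
    {e : ℕ} (hdisj : (S : Set α).PairwiseDisjoint c) (hcard : ∀ a ∈ S, (c a).card = e)
    {t : ℝ} (ht0 : 0 ≤ t) (ht : t ≤ 1) (d : ℝ) :
    (Measure.pi fun _ : ι => bernoulliMeasure true false p).real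
      {ω | d ≤ |(headsCount S c ω : ℝ) - S.card * (p : ℝ) ^ e|}
      ≤ 2 * Real.exp (S.card * (p : ℝ) ^ e * t ^ 2 - t * d) := by
  set P := Measure.pi fun _ : ι => bernoulliMeasure true false p with hP
  set n : ℝ := S.card * (p : ℝ) ^ e with hn
  have hup : P.real {ω | n + d ≤ (headsCount S c ω : ℝ)} ≤ Real.exp (n * t ^ 2 - t * d) := by
    refine (measure_ge_le_exp_mul_mgf (n + d) ht0 (integrable_pi_bool p _)).trans ?_
    refine (mul_le_mul_of_nonneg_left (mgf_headsCount_le p S c hdisj hcard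
      (abs_le.2 ⟨by linarith, ht⟩)) (Real.exp_pos _).le).trans ?_
    rw [← Real.exp_add, ← hn]
    exact Real.exp_le_exp.2 (by ring_nf; rfl)
  have hdown : P.real {ω | (headsCount S c ω : ℝ) ≤ n - d} ≤ Real.exp (n * t ^ 2 - t * d) := by
    refine (measure_le_le_exp_mul_mgf (n - d) (t := -t) (by linarith)
      (integrable_pi_bool p _)).trans ?_
    refine (mul_le_mul_of_nonneg_left (mgf_headsCount_le p S c hdisj hcard
      (abs_le.2 ⟨by linarith, by linarith⟩)) (Real.exp_pos _).le).trans ?_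
    rw [← Real.exp_add, ← hn]
    exact Real.exp_le_exp.2 (by ring_nf; rfl)
  calc _ ≤ P.real ({ω | n + d ≤ (headsCount S c ω : ℝ)} ∪
        {ω | (headsCount S c ω : ℝ) ≤ n - d}) := by
        refine measureReal_mono ?_
        intro ω hω
        rcases le_abs.1 (show d ≤ |(headsCount S c ω : ℝ) - n| from hω) with h | h
        · exact Or.inl (show n + d ≤ _ by linarith)
        · exact Or.inr (show _ ≤ n - d by linarith)
    _ ≤ _ := measureReal_union_le _ _
    _ ≤ _ := by linarith

/-- Concentration of the number of sets of coins all of whose coins come up heads, when every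
coin is used by at most `B` of the sets, each of size `e`. -/
theorem measureReal_abs_headsCount_sub_gt_le (p : unitInterval) (T : Finset α)
    (c : α → Finset ι) (e B : ℕ) (hcard : ∀ a ∈ T, (c a).card = e)
    (hB : ∀ i, ∃ R : Finset α, R.card ≤ B ∧ ∀ a ∈ T, i ∈ c a → a ∈ R)
    {ε : ℝ} (hε0 : 0 ≤ ε) (hε1 : ε ≤ 1) :
    (Measure.pi fun _ : ι => bernoulliMeasure true false p).real
      {ω | ε * (T.card * (p : ℝ) ^ e) < |(headsCount T c ω : ℝ) - T.card * (p : ℝ) ^ e|}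
      ≤ 2 * (e * B + 1 : ℕ) *
        Real.exp (-(ε ^ 2 * (T.card * (p : ℝ) ^ e) / (8 * (e * B + 1 : ℕ)))) := by
  obtain ⟨col, hlt, hcol⟩ := exists_coloring_disjoint T c e B (fun a ha => (hcard a ha).le) hB
  set P := Measure.pi fun _ : ι => bernoulliMeasure true false p with hP
  set χ : ℕ := e * B + 1 with hχ
  set μ : ℝ := (p : ℝ) ^ e with hμ
  have hμ0 : 0 ≤ μ := pow_nonneg p.2.1 _
  have hχ0 : (0 : ℝ) < χ := by positivity
  set q : ℝ := (T.card : ℝ) with hq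
  let S : ℕ → Finset α := fun j => T.filter fun a => col a = j
  -- Half of the allowed error is split by class size, half equally. The equal share keeps small
  -- classes under control, so the colouring need not be balanced.
  let d : ℕ → ℝ := fun j => ε * μ * ((S j).card + q / χ) / 2
  have hmaps : ∀ a ∈ T, col a ∈ Finset.range χ := fun a _ => Finset.mem_range.2 (hlt a)
  have hqsum : q = ∑ j ∈ Finset.range χ, ((S j).card : ℝ) := by
    rw [hq, Finset.card_eq_sum_card_fiberwise hmaps]
    push_cast; rfl
  have hcount : ∀ ω, (headsCount T c ω : ℝ)
      = ∑ j ∈ Finset.range χ, (headsCount (S j) c ω : ℝ) := by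
    intro ω
    have := Finset.card_eq_sum_card_fiberwise (s := T.filter fun a => ∀ i ∈ c a, ω i = true)
      (t := Finset.range χ) (f := col) (fun a ha => hmaps a (Finset.mem_filter.1 ha).1)
    rw [headsCount, this]
    push_cast
    refine Finset.sum_congr rfl fun j _ => ?_
    simp only [headsCount, S, Finset.filter_filter]
    simp only [and_comm]
  have hdsum : ∑ j ∈ Finset.range χ, d j = ε * (q * μ) := by
    simp only [d]
    rw [← Finset.sum_div, ← Finset.mul_sum, Finset.sum_add_distrib, ← hqsum]
    simp only [Finset.sum_const, Finset.card_range, nsmul_eq_mul]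
    field_simp
    ring
  have hsub : {ω | ε * (q * μ) < |(headsCount T c ω : ℝ) - q * μ|} ⊆
      ⋃ j ∈ Finset.range χ, {ω | d j ≤ |(headsCount (S j) c ω : ℝ) - (S j).card * μ|} := by
    intro ω hω
    by_contra hcon
    simp only [Set.mem_iUnion, not_exists, Set.mem_ofPred_eq, not_le] at hcon
    have : |(headsCount T c ω : ℝ) - q * μ| ≤ ε * (q * μ) := by
      conv_lhs => rw [hcount, hqsum, Finset.sum_mul, ← Finset.sum_sub_distrib]
      rw [← hdsum]
      exact (Finset.abs_sum_le_sum_abs _ _).trans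
        (Finset.sum_le_sum fun j hj => (hcon j hj).le)
    exact absurd hω (not_lt.2 this)
  calc _ ≤ P.real (⋃ j ∈ Finset.range χ,
          {ω | d j ≤ |(headsCount (S j) c ω : ℝ) - (S j).card * μ|}) := measureReal_mono hsub (measure_ne_top _ _)
    _ ≤ ∑ j ∈ Finset.range χ,
          P.real {ω | d j ≤ |(headsCount (S j) c ω : ℝ) - (S j).card * μ|} :=
        measureReal_biUnion_finset_le _ _
    _ ≤ ∑ _j ∈ Finset.range χ, 2 * Real.exp (-(ε ^ 2 * (q * μ) / (8 * χ))) := by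
        refine Finset.sum_le_sum fun j _ => ?_
        refine (measureReal_abs_headsCount_sub_ge_le p (S j) c ?_ ?_ (t := ε / 4)
          (by linarith) (by linarith) (d j)).trans ?_
        · intro a ha b hb hab
          have ha' := Finset.mem_filter.1 ha
          have hb' := Finset.mem_filter.1 hb
          exact hcol a ha'.1 b hb'.1 hab (ha'.2.trans hb'.2.symm)
        · exact fun a ha => hcard a (Finset.mem_filter.1 ha).1
        · refine mul_le_mul_of_nonneg_left (Real.exp_le_exp.2 ?_) (by norm_num)
          -- With `t = ε / 4` the equal share yields the target exponent, and the size share, `ε ^ 2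
          -- / 8`, absorbs the quadratic term, `ε ^ 2 / 16`.
          have h1 : 0 ≤ ((S j).card : ℝ) * μ * ε ^ 2 := by positivity
          have h2 : ε / 4 * d j = ε ^ 2 * (q * μ) / (8 * χ) + (S j).card * μ * ε ^ 2 / 8 := by
            simp only [d]; field_simp; ring
          rw [h2]
          linarith
    _ = _ := by
        rw [Finset.sum_const, Finset.card_range, nsmul_eq_mul]; ring

end Concentration

end CliqueMR

namespace CliqueMR

/-! ### The order `≺` and the output of the three rounds -/

section Correctness

variable {V : Type*} [Fintype V] [LinearOrder V] (G : SimpleGraph V) [DecidableRel G.Adj]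

lemma prec_iff_toLex_lt (x y : V) :
    Prec G x y ↔ toLex (G.degree x, x) < toLex (G.degree y, y) := by
  rw [Prod.Lex.toLex_lt_toLex]; rfl

lemma Prec.asymm {x y : V} (h : Prec G x y) : ¬ Prec G y x := by
  rw [prec_iff_toLex_lt] at *
  exact h.asymm

lemma Prec.ne {x y : V} (h : Prec G x y) : x ≠ y := by
  rintro rfl
  exact h.asymm G h

lemma prec_or_prec_of_ne {x y : V} (h : x ≠ y) : Prec G x y ∨ Prec G y x := by
  rw [prec_iff_toLex_lt, prec_iff_toLex_lt]
  refine lt_or_gt_of_ne fun he => h ?_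
  simpa using congrArg (fun z => (ofLex z).2) he

/-- The high-neighbourhood `Γ⁺(u)`. -/
def highNbhd (u : V) : Finset V :=
  Finset.univ.filter fun x => G.Adj u x ∧ Prec G u x

@[simp] lemma mem_highNbhd {u x : V} : x ∈ highNbhd G u ↔ G.Adj u x ∧ Prec G u x := by
  simp [highNbhd]

lemma mem_valuesAt {K W : Type*} [DecidableEq K] [DecidableEq W] {S : Finset (K × W)} {κ : K}
    {w : W} : w ∈ valuesAt S κ ↔ (κ, w) ∈ S := by
  simp only [valuesAt, Finset.mem_image, Finset.mem_filter, Prod.exists]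
  constructor
  · rintro ⟨a, b, ⟨h, rfl⟩, rfl⟩
    exact h
  · exact fun h => ⟨κ, w, ⟨h, rfl⟩, rfl⟩

lemma mem_mapPhase_map1 {u v : V} :
    (u, v) ∈ mapPhase (map1 G) (edgeRecords G) ↔ v ∈ highNbhd G u := by
  simp only [mapPhase, Finset.mem_biUnion, edgeRecords, Finset.mem_filter, Finset.mem_univ,
    true_and, map1, mem_highNbhd]
  constructor
  · rintro ⟨e, he, h⟩
    split_ifs at h with hp
    · rw [Finset.mem_singleton] at h
      subst h
      exact ⟨he, hp⟩
    · simp at h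
  · rintro ⟨h1, h2⟩
    exact ⟨(u, v), h1, by simp [h2]⟩

lemma valuesAt_mapPhase_map1 (u : V) :
    valuesAt (mapPhase (map1 G) (edgeRecords G)) u = highNbhd G u := by
  ext v
  rw [mem_valuesAt, mem_mapPhase_map1]

lemma mem_round1 {k : ℕ} (hk : 2 ≤ k) {u : V} {Γ : Finset V} :
    (u, Γ) ∈ round1 G k ↔ Γ = highNbhd G u ∧ k - 1 ≤ (highNbhd G u).card := by
  simp only [round1, reducePhase, Finset.mem_biUnion, valuesAt_mapPhase_map1, reduce1]
  constructor
  · rintro ⟨v, -, h⟩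
    split_ifs at h with hc
    · obtain ⟨rfl, rfl⟩ := Prod.mk.inj (Finset.mem_singleton.1 h)
      exact ⟨rfl, hc⟩
    · simp at h
  · rintro ⟨rfl, hc⟩
    -- A reduce instance exists only for a key that occurs, so `Γ⁺(u)` must be nonempty; this is
    -- where `2 ≤ k` enters.
    obtain ⟨v, hv⟩ := Finset.card_pos.1 (show 0 < (highNbhd G u).card by omega)
    refine ⟨u, Finset.mem_image.2 ⟨(u, v), (mem_mapPhase_map1 G).2 hv, rfl⟩, ?_⟩
    simp [hc]

lemma none_mem_mapPhase_map2 {k : ℕ} {coin : V × V × V → Bool} {z : V × V} :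
    (z, none) ∈ mapPhase (map2 G coin) ((edgeRecords G).disjSum (round1 G k)) ↔
      G.Adj z.1 z.2 ∧ Prec G z.1 z.2 := by
  simp only [mapPhase, Finset.mem_biUnion, Finset.mem_disjSum]
  constructor
  · rintro ⟨r, ⟨e, he, rfl⟩ | ⟨⟨u, Γ⟩, hr, rfl⟩, h⟩
    · simp only [map2] at h
      split_ifs at h with hp
      · obtain rfl := (Prod.mk.inj (Finset.mem_singleton.1 h)).1
        exact ⟨(Finset.mem_filter.1 he).2, hp⟩
      · simp at h
    · simp [map2] at h
  · rintro ⟨h1, h2⟩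
    exact ⟨Sum.inl z, Or.inl ⟨z, by simp [edgeRecords, h1], rfl⟩, by simp [map2, h2]⟩

lemma some_mem_mapPhase_map2 {k : ℕ} (hk : 2 ≤ k) {coin : V × V × V → Bool} {z : V × V} {u : V} :
    (z, some u) ∈ mapPhase (map2 G coin) ((edgeRecords G).disjSum (round1 G k)) ↔
      k - 1 ≤ (highNbhd G u).card ∧ z.1 ∈ highNbhd G u ∧ z.2 ∈ highNbhd G u ∧
        Prec G z.1 z.2 ∧ coin (u, z) = true := by
  simp only [mapPhase, Finset.mem_biUnion, Finset.mem_disjSum]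
  constructor
  · rintro ⟨r, ⟨e, he, rfl⟩ | ⟨⟨v, Γ⟩, hr, rfl⟩, h⟩
    · simp only [map2] at h
      split_ifs at h <;> simp at h
    · simp only [map2, Finset.mem_image, Finset.mem_filter, Finset.mem_product] at h
      obtain ⟨w, ⟨⟨h1, h2⟩, h3, h4⟩, h5⟩ := h
      obtain ⟨rfl, h6⟩ := Prod.mk.inj h5
      obtain rfl := Option.some.inj h6
      obtain ⟨rfl, hc⟩ := (mem_round1 G hk).1 hr
      exact ⟨hc, h1, h2, h3, h4⟩
  · rintro ⟨hc, h1, h2, h3, h4⟩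
    refine ⟨Sum.inr (u, highNbhd G u), Or.inr ⟨_, (mem_round1 G hk).2 ⟨rfl, hc⟩, rfl⟩, ?_⟩
    simp only [map2, Finset.mem_image, Finset.mem_filter, Finset.mem_product]
    exact ⟨z, ⟨⟨h1, h2⟩, h3, h4⟩, rfl⟩

/-- The edges that the third round collects for `u`: the sampled edges of `G⁺(u)`. -/
lemma mem_mapPhase_map3 {k : ℕ} (hk : 2 ≤ k) {coin : V × V × V → Bool} {z : V × V} {u : V} :
    (u, z) ∈ mapPhase map3 (round2 G k coin) ↔
      G.Adj z.1 z.2 ∧ k - 1 ≤ (highNbhd G u).card ∧ z.1 ∈ highNbhd G u ∧ z.2 ∈ highNbhd G u ∧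
        Prec G z.1 z.2 ∧ coin (u, z) = true := by
  have hz : (u, z) ∈ mapPhase map3 (round2 G k coin) ↔
      ∃ U, (z, U) ∈ round2 G k coin ∧ u ∈ U := by
    simp only [mapPhase, map3, Finset.mem_biUnion, Finset.mem_image]
    constructor
    · rintro ⟨⟨w, U⟩, hr, v, hv, h⟩
      obtain ⟨rfl, rfl⟩ := Prod.mk.inj h
      exact ⟨U, hr, hv⟩
    · rintro ⟨U, hr, hu⟩
      exact ⟨(z, U), hr, u, hu, rfl⟩
  rw [hz, ← some_mem_mapPhase_map2 G hk]
  simp only [round2, reducePhase, Finset.mem_biUnion, reduce2, mem_valuesAt,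
    none_mem_mapPhase_map2]
  constructor
  · rintro ⟨U, ⟨w, -, h⟩, hu⟩
    split_ifs at h with hp
    · obtain ⟨rfl, rfl⟩ := Prod.mk.inj (Finset.mem_singleton.1 h)
      rw [Finset.mem_eraseNone, mem_valuesAt] at hu
      exact ⟨hp.1, hu⟩
    · simp at h
  · rintro ⟨hadj, hu⟩
    refine ⟨Finset.eraseNone (valuesAt
        (mapPhase (map2 G coin) ((edgeRecords G).disjSum (round1 G k))) z),
      ⟨z, Finset.mem_image.2 ⟨_, hu, rfl⟩, ?_⟩, ?_⟩
    · rw [if_pos ⟨hadj, ((some_mem_mapPhase_map2 G hk).1 hu).2.2.2.1⟩, Finset.mem_singleton]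
    · rw [Finset.mem_eraseNone, mem_valuesAt]
      exact hu

lemma countCliques_empty {j : ℕ} (hj : 2 ≤ j) : countCliques j (∅ : Finset (V × V)) = 0 := by
  rw [countCliques, Finset.card_eq_zero, Finset.eq_empty_iff_forall_notMem]
  intro S hS
  rw [SimpleGraph.mem_cliqueFinset_iff] at hS
  obtain ⟨x, hx, y, hy, hxy⟩ := Finset.one_lt_card.1 (show 1 < S.card by rw [hS.card_eq]; omega)
  simpa using hS.isClique hx hy hxy

/-- Records carry their key `u`, so equal partial estimates are not merged in the set of outputs;
nodes that receive no edge contribute zero. -/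
lemma estimate_eq_sum {k : ℕ} (hk : 3 ≤ k) (p : ℝ) (coin : V × V × V → Bool) :
    estimate G k p coin = ∑ u, (countCliques (k - 1)
      (valuesAt (mapPhase map3 (round2 G k coin)) u) : ℝ) / p ^ ((k - 1) * (k - 2) / 2) := by
  simp only [estimate, round3, reducePhase, reduce3]
  rw [Finset.sum_biUnion]
  · simp only [Finset.sum_singleton]
    refine Finset.sum_subset (Finset.subset_univ _) fun u _ hu => ?_
    have : valuesAt (mapPhase map3 (round2 G k coin)) u = ∅ := by
      rw [Finset.eq_empty_iff_forall_notMem]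
      intro z hz
      exact hu (Finset.mem_image.2 ⟨_, mem_valuesAt.1 hz, rfl⟩)
    rw [this, countCliques_empty (by omega)]
    simp
  · intro u _ v _ huv
    simp [Function.onFun, huv]

/-! ### Rooted cliques and their coins -/

/-- The coins `(u, x, y)` with `x ≺ y` in `S`. -/
def coinsOf (a : V × Finset V) : Finset (V × V × V) :=
  ((a.2 ×ˢ a.2).filter fun z => Prec G z.1 z.2).image fun z => (a.1, z)

lemma mem_coinsOf {a : V × Finset V} {i : V × V × V} :
    i ∈ coinsOf G a ↔ i.1 = a.1 ∧ i.2.1 ∈ a.2 ∧ i.2.2 ∈ a.2 ∧ Prec G i.2.1 i.2.2 := by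
  obtain ⟨u, x, y⟩ := i
  simp only [coinsOf, Finset.mem_image, Finset.mem_filter, Finset.mem_product, Prod.mk.injEq,
    Prod.exists]
  constructor
  · rintro ⟨x', y', ⟨⟨h1, h2⟩, h3⟩, rfl, rfl, rfl⟩
    exact ⟨rfl, h1, h2, h3⟩
  · rintro ⟨rfl, h1, h2, h3⟩
    exact ⟨x, y, ⟨⟨h1, h2⟩, h3⟩, rfl, rfl, rfl⟩

/-- By totality of `≺`, the off-diagonal pairs split into the increasing ones and their swaps. -/
lemma card_coinsOf (a : V × Finset V) :
    (coinsOf G a).card = a.2.card * (a.2.card - 1) / 2 := by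
  rw [coinsOf, Finset.card_image_of_injective _ (Prod.mk_right_injective a.1)]
  set A := (a.2 ×ˢ a.2).filter fun z => Prec G z.1 z.2 with hA
  have hswap : (A.image Prod.swap).card = A.card :=
    Finset.card_image_of_injective _ Prod.swap_injective
  have hunion : a.2.offDiag = A ∪ A.image Prod.swap := by
    ext ⟨x, y⟩
    simp only [Finset.mem_offDiag, Finset.mem_union, hA, Finset.mem_filter, Finset.mem_product,
      Finset.mem_image, Prod.exists, Prod.swap_prod_mk, Prod.mk.injEq]
    constructor
    · rintro ⟨hx, hy, hne⟩
      rcases prec_or_prec_of_ne G hne with h | h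
      · exact Or.inl ⟨⟨hx, hy⟩, h⟩
      · exact Or.inr ⟨y, x, ⟨⟨hy, hx⟩, h⟩, rfl, rfl⟩
    · rintro (⟨⟨hx, hy⟩, h⟩ | ⟨x', y', ⟨⟨hx, hy⟩, h⟩, rfl, rfl⟩)
      · exact ⟨hx, hy, h.ne⟩
      · exact ⟨hy, hx, h.ne.symm⟩
  have hdisj : Disjoint A (A.image Prod.swap) := by
    rw [Finset.disjoint_left]
    rintro ⟨x, y⟩ h1 h2
    simp only [hA, Finset.mem_filter, Finset.mem_image, Prod.exists, Prod.swap_prod_mk,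
      Prod.mk.injEq] at h1 h2
    obtain ⟨x', y', h2, rfl, rfl⟩ := h2
    exact h1.2.asymm G h2.2
  have h := congrArg Finset.card hunion
  rw [Finset.card_union_of_disjoint hdisj, hswap, Finset.offDiag_card] at h
  rw [Nat.mul_sub_one, h]
  omega

/-- The `k`-cliques of `G`, each given as its `≺`-minimum together with its other nodes. -/
def rootedCliques (k : ℕ) : Finset (V × Finset V) :=
  (Finset.univ ×ˢ G.cliqueFinset (k - 1)).filter fun a => a.2 ⊆ highNbhd G a.1

lemma mem_rootedCliques {k : ℕ} {a : V × Finset V} :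
    a ∈ rootedCliques G k ↔ G.IsNClique (k - 1) a.2 ∧ a.2 ⊆ highNbhd G a.1 := by
  simp [rootedCliques]

lemma card_rootedCliques {k : ℕ} (hk : 1 ≤ k) :
    (rootedCliques G k).card = (G.cliqueFinset k).card := by
  refine Finset.card_bij (fun a _ => insert a.1 a.2) ?_ ?_ ?_
  · intro a ha
    obtain ⟨h1, h2⟩ := (mem_rootedCliques G).1 ha
    rw [SimpleGraph.mem_cliqueFinset_iff]
    have := h1.insert (a := a.1) fun b hb => ((mem_highNbhd G).1 (h2 hb)).1
    rwa [Nat.sub_add_cancel hk] at this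
  · rintro ⟨u, S⟩ ha ⟨v, S'⟩ hb (h : insert u S = insert v S')
    obtain ⟨-, h2⟩ := (mem_rootedCliques G).1 ha
    obtain ⟨-, h2'⟩ := (mem_rootedCliques G).1 hb
    have huS : u ∉ S := fun hu => ((mem_highNbhd G).1 (h2 hu)).2.ne G rfl
    have hvS : v ∉ S' := fun hv => ((mem_highNbhd G).1 (h2' hv)).2.ne G rfl
    -- Two different roots of one clique would each precede the other.
    have huv : u = v := by
      by_contra hne
      have hv : v ∈ S := (Finset.mem_insert.1 (h ▸ Finset.mem_insert_self v S')).resolve_left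
        (Ne.symm hne)
      have hu : u ∈ S' := (Finset.mem_insert.1 (h ▸ Finset.mem_insert_self u S)).resolve_left hne
      exact ((mem_highNbhd G).1 (h2 hv)).2.asymm G ((mem_highNbhd G).1 (h2' hu)).2
    subst huv
    rw [← Finset.erase_insert huS, h, Finset.erase_insert hvS]
  · intro C hC
    rw [SimpleGraph.mem_cliqueFinset_iff] at hC
    obtain ⟨u, hu, hmin⟩ := Finset.exists_min_image C (fun x => toLex (G.degree x, x))
      (Finset.card_pos.1 (by rw [hC.card_eq]; omega))
    refine ⟨(u, C.erase u), (mem_rootedCliques G).2 ⟨?_, ?_⟩, Finset.insert_erase hu⟩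
    · exact ⟨hC.isClique.subset (by simp), by rw [Finset.card_erase_of_mem hu, hC.card_eq]⟩
    · intro x hx
      obtain ⟨hxu, hxC⟩ := Finset.mem_erase.1 hx
      refine (mem_highNbhd G).2 ⟨hC.isClique hu hxC hxu.symm, ?_⟩
      refine (prec_or_prec_of_ne G hxu).resolve_left fun h => ?_
      exact absurd ((prec_iff_toLex_lt G _ _).1 h) (not_lt.2 (hmin x hxC))

lemma countCliques_eq {k : ℕ} (hk : 3 ≤ k) (coin : V × V × V → Bool) (u : V) :
    countCliques (k - 1) (valuesAt (mapPhase map3 (round2 G k coin)) u) =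
      ((G.cliqueFinset (k - 1)).filter fun S => S ⊆ highNbhd G u ∧
        ∀ i ∈ coinsOf G (u, S), coin i = true).card := by
  rw [countCliques]
  congr 1
  ext S
  simp only [SimpleGraph.mem_cliqueFinset_iff, Finset.mem_filter]
  have hE : ∀ x y, (x, y) ∈ valuesAt (mapPhase map3 (round2 G k coin)) u ↔ _ := fun x y =>
    mem_valuesAt.trans (mem_mapPhase_map3 G (by omega))
  constructor
  · intro hS
    have hadj : ∀ x ∈ S, ∀ y ∈ S, x ≠ y →
        (x, y) ∈ valuesAt (mapPhase map3 (round2 G k coin)) u ∨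
        (y, x) ∈ valuesAt (mapPhase map3 (round2 G k coin)) u :=
      fun x hx y hy hxy => (SimpleGraph.fromRel_adj _ _ _ |>.1 (hS.isClique hx hy hxy)).2
    refine ⟨⟨fun x hx y hy hxy => ?_, hS.card_eq⟩, fun x hx => ?_, ?_⟩
    · rcases hadj x hx y hy hxy with h | h
      · exact ((hE _ _).1 h).1
      · exact ((hE _ _).1 h).1.symm
    -- As `k - 1 ≥ 2`, each node of `S` lies on a collected edge, whose ends are in `Γ⁺(u)`.
    · obtain ⟨y, hy, hxy⟩ := Finset.exists_mem_ne
        (show 1 < S.card by rw [hS.card_eq]; omega) x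
      rcases hadj x hx y hy hxy.symm with h | h
      · exact ((hE _ _).1 h).2.2.1
      · exact ((hE _ _).1 h).2.2.2.1
    · rintro ⟨v, x, y⟩ hi
      obtain ⟨rfl, hx, hy, hp⟩ := (mem_coinsOf G).1 hi
      rcases hadj x hx y hy (hp.ne G) with h | h
      · exact ((hE _ _).1 h).2.2.2.2.2
      · exact absurd ((hE _ _).1 h).2.2.2.2.1 (hp.asymm G)
  · rintro ⟨hS, hsub, hcoin⟩
    -- The threshold of round 1 loses no clique.
    have hcard : k - 1 ≤ (highNbhd G u).card := hS.card_eq ▸ Finset.card_le_card hsub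
    have hmem : ∀ x ∈ S, ∀ y ∈ S, Prec G x y →
        (x, y) ∈ valuesAt (mapPhase map3 (round2 G k coin)) u := fun x hx y hy hp =>
      (hE x y).2 ⟨hS.isClique hx hy (hp.ne G), hcard, hsub hx, hsub hy, hp,
        hcoin (u, x, y) ((mem_coinsOf G).2 ⟨rfl, hx, hy, hp⟩)⟩
    refine ⟨fun x hx y hy hxy => ?_, hS.card_eq⟩
    rw [SimpleGraph.fromRel_adj]
    exact ⟨hxy, (prec_or_prec_of_ne G hxy).imp (hmem x hx y hy) (hmem y hy x hx)⟩

/-- The estimate counts the cliques all of whose coins came up heads. -/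
theorem estimate_eq_headsCount_div {k : ℕ} (hk : 3 ≤ k) (p : ℝ) (coin : V × V × V → Bool) :
    estimate G k p coin =
      (headsCount (rootedCliques G k) (coinsOf G) coin : ℝ) / p ^ ((k - 1) * (k - 2) / 2) := by
  rw [estimate_eq_sum G hk, ← Finset.sum_div, ← Nat.cast_sum]
  congr 2
  rw [headsCount, Finset.card_eq_sum_card_fiberwise (f := Prod.fst) (t := Finset.univ)
    (fun _ _ => Finset.mem_coe.2 (Finset.mem_univ _))]
  refine Finset.sum_congr rfl fun u _ => ?_
  rw [countCliques_eq G hk]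
  refine Finset.card_bij (fun S _ => (u, S)) ?_ ?_ ?_
  · intro S hS
    simp only [Finset.mem_filter, SimpleGraph.mem_cliqueFinset_iff] at hS
    simp only [Finset.mem_filter, mem_rootedCliques]
    exact ⟨⟨⟨hS.1, hS.2.1⟩, hS.2.2⟩, trivial⟩
  · intro S _ S' _ h
    exact (Prod.mk.inj h).2
  · rintro ⟨v, S⟩ h
    simp only [Finset.mem_filter, mem_rootedCliques] at h
    obtain ⟨⟨⟨h1, h2⟩, h3⟩, rfl⟩ := h
    exact ⟨S, by simpa only [Finset.mem_filter, SimpleGraph.mem_cliqueFinset_iff] using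
      ⟨h1, h2, h3⟩, rfl⟩

/-- Each of the `|Γ⁺(u)|` nodes above `u` has degree at least `d(u) ≥ |Γ⁺(u)|`, and all degrees sum
to `2m`. -/
lemma card_highNbhd_sq_le (u : V) :
    (highNbhd G u).card ^ 2 ≤ 2 * G.edgeFinset.card := by
  have hdeg : (highNbhd G u).card ≤ G.degree u := by
    rw [← SimpleGraph.card_neighborFinset_eq_degree]
    exact Finset.card_le_card fun x hx => by simpa using ((mem_highNbhd G).1 hx).1
  calc (highNbhd G u).card ^ 2 = ∑ _x ∈ highNbhd G u, (highNbhd G u).card := by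
        simp [sq]
    _ ≤ ∑ x ∈ highNbhd G u, G.degree x := by
        refine Finset.sum_le_sum fun x hx => hdeg.trans ?_
        rcases ((mem_highNbhd G).1 hx).2 with h | h
        · exact h.le
        · exact h.1.le
    _ ≤ ∑ x, G.degree x := Finset.sum_le_sum_of_subset (Finset.subset_univ _)
    _ = _ := G.sum_degrees_eq_twice_card_edges

/-- Every coin is used by few of the cliques. -/
lemma exists_card_le_of_mem_coinsOf {k : ℕ} (hk : 3 ≤ k) (i : V × V × V) :
    ∃ R : Finset (V × Finset V), R.card ≤ (2 * G.edgeFinset.card).sqrt ^ (k - 3) ∧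
      ∀ a ∈ rootedCliques G k, i ∈ coinsOf G a → a ∈ R := by
  obtain ⟨u, x, y⟩ := i
  -- The coin fixes the root and two nodes; the other `k - 3` lie in `Γ⁺(u)`.
  refine ⟨((highNbhd G u).powersetCard (k - 3)).image fun S => (u, insert x (insert y S)),
    ?_, ?_⟩
  · refine Finset.card_image_le.trans ?_
    rw [Finset.card_powersetCard]
    refine (Nat.choose_le_pow _ _).trans (Nat.pow_le_pow_left ?_ _)
    rw [Nat.le_sqrt']
    exact card_highNbhd_sq_le G u
  · rintro ⟨v, S⟩ ha hi
    obtain ⟨h1, h2⟩ := (mem_rootedCliques G).1 ha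
    obtain ⟨rfl, hx, hy, hp⟩ := (mem_coinsOf G).1 hi
    have hyS : y ∈ S.erase x := Finset.mem_erase.2 ⟨(hp.ne G).symm, hy⟩
    refine Finset.mem_image.2 ⟨(S.erase x).erase y, Finset.mem_powersetCard.2 ⟨?_, ?_⟩, ?_⟩
    · exact ((Finset.erase_subset _ _).trans (Finset.erase_subset _ _)).trans h2
    · rw [Finset.card_erase_of_mem hyS, Finset.card_erase_of_mem hx, h1.card_eq]
      omega
    · rw [Finset.insert_erase hyS, Finset.insert_erase hx]

end Correctness

end CliqueMR

/-! ### Tail bound for the estimate and choice of constants -/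

namespace CliqueMR

/-- Tail bound for the estimate, in terms of the number `e` of coins of a clique and the bound
`B` on the number of cliques that use a coin. -/
lemma measureReal_abs_estimate_sub_le_ge {V : Type*} [Fintype V] [LinearOrder V]
    (G : SimpleGraph V) [DecidableRel G.Adj] {k : ℕ} (hk : 3 ≤ k) (p : unitInterval)
    {ε δ : ℝ} (hδ0 : 0 ≤ δ) (hδ1 : δ ≤ 1) (hδε : δ ≤ ε) {e B q : ℕ}
    (he : e = (k - 1) * (k - 2) / 2) (hB : B = (2 * G.edgeFinset.card).sqrt ^ (k - 3))
    (hq : q = (G.cliqueFinset k).card) (hp : 0 < (p : ℝ) ^ e) :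
    1 - 2 * (e * B + 1 : ℕ) * Real.exp (-(δ ^ 2 * (q * (p : ℝ) ^ e) / (8 * (e * B + 1 : ℕ)))) ≤
      (coinLaw V p).real {coin | |estimate G k p coin - q| ≤ ε * q} := by
  subst hB
  have hT : (rootedCliques G k).card = q := by rw [card_rootedCliques G (by omega), hq]
  have hcard : ∀ a ∈ rootedCliques G k, (coinsOf G a).card = e := by
    intro a ha
    rw [card_coinsOf, ((mem_rootedCliques G).1 ha).1.card_eq, he]
    congr 2
  have key := measureReal_abs_headsCount_sub_gt_le p (rootedCliques G k) (coinsOf G) e _ hcard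
    (exists_card_le_of_mem_coinsOf G hk) hδ0 hδ1
  rw [hT] at key
  set P := Measure.pi fun _ : V × V × V => bernoulliMeasure true false p with hP
  have hlaw : coinLaw V p = P := rfl
  rw [hlaw]
  set bad := {ω : V × V × V → Bool | δ * (q * (p : ℝ) ^ e) <
    |(headsCount (rootedCliques G k) (coinsOf G) ω : ℝ) - q * (p : ℝ) ^ e|} with hbad
  have hcompl : P.real badᶜ = 1 - P.real bad :=
    probReal_compl_eq_one_sub (Set.Finite.measurableSet (Set.toFinite _))
  refine (show _ ≤ P.real badᶜ by rw [hcompl]; linarith).trans (measureReal_mono ?_)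
  intro ω hω
  have hω' := not_lt.1 (show ¬ δ * (q * (p : ℝ) ^ e) < _ from hω)
  change |estimate G k p ω - q| ≤ ε * q
  rw [estimate_eq_headsCount_div G hk, ← he]
  have hdiv : (headsCount (rootedCliques G k) (coinsOf G) ω : ℝ) / (p : ℝ) ^ e - q =
      (headsCount (rootedCliques G k) (coinsOf G) ω - q * (p : ℝ) ^ e) / (p : ℝ) ^ e := by
    field_simp
  rw [hdiv, abs_div, abs_of_pos hp, div_le_iff₀ hp]
  calc _ ≤ δ * (q * (p : ℝ) ^ e) := hω'
    _ ≤ ε * (q * (p : ℝ) ^ e) := by gcongr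
    _ = _ := by ring

lemma sqrt_two_mul_pow_le {m k : ℕ} (hk : 3 ≤ k) :
    (((2 * m).sqrt ^ (k - 3) : ℕ) : ℝ) ≤ 2 ^ (k - 3) * (m : ℝ) ^ (((k : ℝ) - 3) / 2) := by
  have h1 : ((2 * m).sqrt : ℝ) ≤ 2 * Real.sqrt m := by
    refine (Real.nat_sqrt_le_real_sqrt).trans ?_
    rw [Real.sqrt_le_left (by positivity), mul_pow, Real.sq_sqrt (by positivity)]
    push_cast
    nlinarith [(Nat.cast_nonneg m : (0 : ℝ) ≤ m)]
  have h2 : (m : ℝ) ^ (((k : ℝ) - 3) / 2) = Real.sqrt m ^ (k - 3) := by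
    rw [Real.sqrt_eq_rpow, ← Real.rpow_natCast, ← Real.rpow_mul (by positivity)]
    congr 1
    push_cast [Nat.cast_sub hk]
    ring
  rw [h2, ← mul_pow]
  push_cast
  gcongr

end CliqueMR

theorem theorem3 (k : ℕ) (hk : 3 ≤ k) (ε : ℝ) (hε : 0 < ε) :
    ∃ h : ℝ, 0 < h ∧ ∃ m₀ : ℕ,
      ∀ (V : Type*) [Fintype V] [LinearOrder V] (G : SimpleGraph V) [DecidableRel G.Adj]
        (m q : ℕ) (p : unitInterval),
        m = G.edgeFinset.card → q = (G.cliqueFinset k).card → m₀ ≤ m →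
        (p : ℝ) ^ ((k - 1) * (k - 2) / 2) >
          h * (m : ℝ) ^ (((k : ℝ) - 3) / 2) * Real.log m / (ε ^ 2 * q) →
        (CliqueMR.coinLaw V p).real
          {coin | |CliqueMR.estimate G k p coin - q| ≤ ε * q} ≥ 1 - 1 / (m : ℝ) := by
  obtain ⟨e, he⟩ : ∃ e, e = (k - 1) * (k - 2) / 2 := ⟨_, rfl⟩
  -- The tail bound needs an error parameter at most 1; the factor `ε ^ 2 / δ ^ 2` in `h`
  -- compensates.
  obtain ⟨δ, hδ⟩ : ∃ δ, δ = min ε 1 := ⟨_, rfl⟩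
  have hδ0 : 0 < δ := hδ ▸ lt_min hε one_pos
  obtain ⟨c, hc⟩ : ∃ c : ℝ, c = e * 2 ^ (k - 3) + 1 := ⟨_, rfl⟩
  have hc0 : 1 ≤ c := by rw [hc]; linarith [show (0 : ℝ) ≤ e * 2 ^ (k - 3) by positivity]
  have hk0 : (0 : ℝ) < k := by exact_mod_cast (by omega : 0 < k)
  refine ⟨8 * c * k * ε ^ 2 / δ ^ 2, by positivity, ⌈2 * c⌉₊, ?_⟩
  intro V _ _ G _ m q p hm hq hm₀ hp
  have hm2 : 2 * c ≤ m := (Nat.le_ceil _).trans (by exact_mod_cast hm₀)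
  have hm1 : (1 : ℝ) ≤ m := by linarith
  have hm0 : (0 : ℝ) < m := by linarith
  have hlog : 0 ≤ Real.log m := Real.log_nonneg hm1
  set M : ℝ := (m : ℝ) ^ (((k : ℝ) - 3) / 2) with hM
  have hk3 : (3 : ℝ) ≤ k := by exact_mod_cast hk
  have hM1 : 1 ≤ M := Real.one_le_rpow hm1 (by linarith)
  rw [← he] at hp
  have hpe : 0 < (p : ℝ) ^ e := lt_of_le_of_lt (by positivity) hp
  have hbound := CliqueMR.measureReal_abs_estimate_sub_le_ge G hk p hδ0.le
    (hδ ▸ min_le_right _ _) (hδ ▸ min_le_left _ _ : δ ≤ ε) he rfl hq hpe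
  -- For `q = 0` the tail bound is void, and division by zero makes the hypothesis just `p ^ e > 0`;
  -- but the estimate is then always 0.
  rcases Nat.eq_zero_or_pos q with hq0 | hq0
  · have hT : CliqueMR.rootedCliques G k = ∅ := by
      rw [← Finset.card_eq_zero, CliqueMR.card_rootedCliques G (by omega), ← hq, hq0]
    have huniv : {coin | |CliqueMR.estimate G k p coin - q| ≤ ε * q} = Set.univ := by
      ext ω
      simp [CliqueMR.estimate_eq_headsCount_div G hk, hT, CliqueMR.headsCount, hq0]
    have : IsProbabilityMeasure (CliqueMR.coinLaw V p) := by
      unfold CliqueMR.coinLaw; infer_instance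
    rw [huniv, probReal_univ]
    linarith [show 0 ≤ 1 / (m : ℝ) by positivity]
  · refine le_trans ?_ hbound
    rw [← hm]
    obtain ⟨χ, hχ⟩ : ∃ χ : ℕ, χ = e * (2 * m).sqrt ^ (k - 3) + 1 := ⟨_, rfl⟩
    rw [← hχ]
    have hχ0 : (0 : ℝ) < χ := by rw [hχ]; positivity
    have hχc : (χ : ℝ) ≤ c * M := by
      have h1 := mul_le_mul_of_nonneg_left (CliqueMR.sqrt_two_mul_pow_le (m := m) hk)
        (Nat.cast_nonneg e : (0 : ℝ) ≤ e)
      rw [hχ, hc]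
      push_cast at h1 ⊢
      linarith
    have hqR : (0 : ℝ) < q := by exact_mod_cast hq0
    have hmain : 8 * c * k * M * Real.log m ≤ δ ^ 2 * (q * (p : ℝ) ^ e) := by
      have h1 := hp.le
      rw [div_le_iff₀ (by positivity)] at h1
      have h2 : 8 * c * k * ε ^ 2 / δ ^ 2 * M * Real.log m =
          ε ^ 2 * (8 * c * k * M * Real.log m / δ ^ 2) := by ring
      have h3 : 8 * c * k * M * Real.log m / δ ^ 2 ≤ (q : ℝ) * (p : ℝ) ^ e := by
        refine le_of_mul_le_mul_left ?_ (show 0 < ε ^ 2 by positivity)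
        rw [← h2]
        linarith
      rw [div_le_iff₀ (by positivity)] at h3
      linarith
    have hexp : (k : ℝ) * Real.log m ≤ δ ^ 2 * (q * (p : ℝ) ^ e) / (8 * χ) := by
      rw [le_div_iff₀ (by positivity)]
      refine le_trans ?_ hmain
      have := mul_le_mul_of_nonneg_left hχc (show 0 ≤ 8 * (k * Real.log m) by positivity)
      linarith
    have hMm : M ≤ (m : ℝ) ^ ((k : ℝ) - 2) :=
      Real.rpow_le_rpow_of_exponent_le hm1 (by linarith)
    have hpow : Real.exp (-(δ ^ 2 * (q * (p : ℝ) ^ e) / (8 * χ))) ≤ (m : ℝ) ^ (-(k : ℝ)) := by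
      rw [Real.rpow_def_of_pos hm0]
      exact Real.exp_le_exp.2 (by linarith)
    -- `m₀` ensures `2c ≤ m`, so `2χ ≤ m * m ^ (k - 2)`, against `m ^ (-k)` from the exponential.
    have hfin : 2 * (χ : ℝ) * Real.exp (-(δ ^ 2 * (q * (p : ℝ) ^ e) / (8 * χ))) ≤ 1 / m := by
      calc _ ≤ (m * (m : ℝ) ^ ((k : ℝ) - 2)) * (m : ℝ) ^ (-(k : ℝ)) := by
            refine mul_le_mul ?_ hpow (Real.exp_pos _).le (by positivity)
            calc 2 * (χ : ℝ) ≤ (2 * c) * M := by linarith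
              _ ≤ m * (m : ℝ) ^ ((k : ℝ) - 2) := by gcongr
        _ = (m : ℝ) ^ (1 + ((k : ℝ) - 2) + -(k : ℝ)) := by
            rw [Real.rpow_add hm0, Real.rpow_add hm0, Real.rpow_one]
        _ = 1 / m := by
            rw [show 1 + ((k : ℝ) - 2) + -(k : ℝ) = -1 by ring, Real.rpow_neg_one, one_div]
    linarith
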